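/- Let $n\ge 1$ and let $\mathbb S^{n-1}$ be the unit sphere of $\mathbb R^n$. Let $\mathcal K^n_o$ be the set of compact convex sets in $\mathbb R^n$ containing the origin in their interior. For $K\in\mathcal K^n_o$ and $v\in\mathbb S^{n-1}$ put $\rho_K(v)=\max\{a\in\mathbb R: av\in K\}$ and $r_K(v)=\rho_K(v)v\in\partial K$. For $x\in\partial K$ let $N(K,x)=\{w\in\mathbb S^{n-1}:(y-x)\cdot w\le 0\ \text{for all } y\in K\}$, and for $\omega\subset\mathbb S^{n-1}$ let $\boldsymbol\alpha_K(\omega)=\bigcup_{x\in r_K(\omega)}N(K,x)$. For a discrete measure $\lambda$ on $\mathbb S^{n-1}$ let $\lambda(K,\omega)=\lambda(\boldsymbol\alpha_K(\omega))$ for Borel $\omega\subset\mathbb S^{n-1}$; "$\mu=\lambda(K,\cdot)$" means $\mu(\omega)=\lambda(K,\omega)$ for every Borel $\omega\subset\mathbb S^{n-1}$. Let $\lambda=\sum_{j=1}^k\delta_{u_j}$ with $u_1,\dots,u_k\in\mathbb S^{n-1}$ (repetitions are allowed), and let $\mu=\sum_{i=1}^m\mu_i\delta_{v_i}$ with distinct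 $v_1,\dots,v_m\in\mathbb S^{n-1}$ and positive integers $\mu_i$. Suppose that $\lambda$ and $\mu$ are weak Aleksandrov related, that is, $$\lambda(\mathbb S^{n-1})=\mu(\mathbb S^{n-1})\ \ge\ \mu(\omega)+\lambda(\omega^*)$$ for every compact $\omega\subset\mathbb S^{n-1}$ for which the cone $\{tx:t\ge0,\ x\in\omega\}$ is nonempty, convex and not all of $\mathbb R^n$, where $\omega^*=\bigcap_{x\in\omega}\{w\in\mathbb S^{n-1}:x\cdot w\le0\}$. Suppose also that $\mu$ is not concentrated on a closed hemisphere. Let $\mathbb F$ be the set of assignment functions, i.e. of $f:\{1,\dots,k\}\to\{1,\dots,m\}$ with $|f^{-1}(i)|=\mu_i$ for all $i$, and let $\mathbb F_p=\{f\in\mathbb F: u_j\cdot v_{f(j)}>0\ \text{for all } j\}$ be the set of proper ones. For $f\in\mathbb F$ let $A(f)=\sum_{j=1}^k\log(u_j\cdot v_{f(j)})\in[-\infty,0]$, where $\log x=-\infty$ for $x\le0$. Call $f\in\mathbb F$ a solution function if there is $K\in\mathcal K^n_o$ such that $\mu=\lambda(K,\cdot)$ and $u_j\in\operatorname{int}\boldsymbol\alpha_K(\{v_{f(j)}\})$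 (interior relative to $\mathbb S^{n-1}$) for all $j$. Let $\mathcal P_\mu\subset\mathcal K^n_o$ be the set of polytopes $P\in\mathcal K^n_o$ of the form $P=\big(\bigcap_{i=1}^m\{x:x\cdot v_i\le a_i\}\big)^*$ with $a_1,\dots,a_m>0$, where $L^*=\{x:x\cdot y\le1\ \text{for all } y\in L\}$ for $L\subset\mathbb R^n$, whose vertices are exactly the points $r_P(v_1),\dots,r_P(v_m)$. Then $\mathbb F_p$ is nonempty, and $f\in\mathbb F$ is a solution function if and only if $f$ is the unique maximizer of $A$ over $\mathbb F$. Moreover, one of the following holds: 1. $A$ is maximized over $\mathbb F$ at exactly one $f\in\mathbb F$, and for this $f$ there is a polytope $P\in\mathcal P_\mu$ such that $\mu=\lambda(P,\cdot)$ and $u_j\in\operatorname{int}\boldsymbol\alpha_P(\{v_{f(j)}\})$ for all $j$; or 2. $A$ is maximized over $\mathbb F$ at more than one $f\in\mathbb F$, and there is no $K\in\mathcal K^n_o$ with $\mu=\lambda(K,\cdot)$. -/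

import Mathlib

noncomputable section

namespace GaussImage

open MeasureTheory
open scoped RealInnerProductSpace ENNReal

/-- Euclidean space `ℝⁿ`. -/
abbrev E (n : ℕ) : Type := EuclideanSpace ℝ (Fin n)

/-- The unit sphere `S^{n-1}` of `ℝⁿ`, with the topology and the Borel σ-algebra of a subspace. -/
abbrev Sph (n : ℕ) : Type := Metric.sphere (0 : E n) 1

/-- Convex bodies of `ℝⁿ` containing the origin in their interior. -/
def convexBodiesO (n : ℕ) : Set (Set (E n)) :=
  {K | IsCompact K ∧ Convex ℝ K ∧ (0 : E n) ∈ interior K}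

/-- The radial function `ρ_K(u) = max {a : a u ∈ K}`. -/
def radialFun {n : ℕ} (K : Set (E n)) (u : Sph n) : ℝ :=
  sSup {a : ℝ | a • (u : E n) ∈ K}

/-- The radial map `r_K(u) = ρ_K(u) u ∈ ∂K`. -/
def radialMap {n : ℕ} (K : Set (E n)) (u : Sph n) : E n :=
  radialFun K u • (u : E n)

/-- `N(K, x)`: the outer unit normals of `K` at `x`. -/
def normalCone {n : ℕ} (K : Set (E n)) (x : E n) : Set (Sph n) :=
  {v | ∀ y ∈ K, ⟪y - x, (v : E n)⟫ ≤ 0}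

/-- The radial Gauss image of a subset `ω` of the sphere, the union of `N(K, x)`
over `x ∈ r_K(ω)`. -/
def radialGaussImage {n : ℕ} (K : Set (E n)) (ω : Set (Sph n)) : Set (Sph n) :=
  ⋃ x ∈ radialMap K '' ω, normalCone K x

/-- The discrete measure `∑ i, c i • δ_{x i}` on the sphere. (Its value on an arbitrary set `s`
is the sum of the `c i` with `x i ∈ s`, since singletons are measurable.) -/
def discreteMeasure {n N : ℕ} (c : Fin N → ℝ) (x : Fin N → Sph n) : Measure (Sph n) :=
  ∑ i, ENNReal.ofReal (c i) • Measure.dirac (x i)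

/-- The Gauss image measure `λ(K, ·)`, as a set function: `λ(K, ω) = λ(α_K(ω))`. -/
def gaussImageMeasure {n : ℕ} (lam : Measure (Sph n)) (K : Set (E n)) (ω : Set (Sph n)) : ℝ≥0∞ :=
  lam (radialGaussImage K ω)

/-- `μ = λ(K, ·)`, an equality of set functions on the Borel subsets of the sphere. -/
def SolvesGaussImage {n : ℕ} (lam μ : Measure (Sph n)) (K : Set (E n)) : Prop :=
  ∀ ω : Set (Sph n), MeasurableSet ω → μ ω = gaussImageMeasure lam K ω

/-- The cone `{t u : t ≥ 0, u ∈ ω}` generated by `ω`. -/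
def coneOf {n : ℕ} (ω : Set (Sph n)) : Set (E n) :=
  {x | ∃ t : ℝ, 0 ≤ t ∧ ∃ u ∈ ω, x = t • (u : E n)}

/-- `ω` is spherically convex: the cone it generates is nonempty, convex and not all of `ℝⁿ`. -/
def SphericallyConvex {n : ℕ} (ω : Set (Sph n)) : Prop :=
  (coneOf ω).Nonempty ∧ Convex ℝ (coneOf ω) ∧ coneOf ω ≠ Set.univ

/-- The polar set `ω^*` within the sphere. -/
def polarSet {n : ℕ} (ω : Set (Sph n)) : Set (Sph n) :=
  ⋂ u ∈ ω, {v : Sph n | ⟪(u : E n), (v : E n)⟫ ≤ 0}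

/-- `λ(S) = μ(S) ≥ μ(ω) + λ(ω^*)` for every compact spherically convex `ω`. -/
def WeakAleksandrovRelated {n : ℕ} (lam μ : Measure (Sph n)) : Prop :=
  lam Set.univ = μ Set.univ ∧
    ∀ ω : Set (Sph n), IsCompact ω → SphericallyConvex ω →
      μ ω + lam (polarSet ω) ≤ μ Set.univ

/-- The closed hemisphere centred at `w`. -/
def closedHemisphere {n : ℕ} (w : Sph n) : Set (Sph n) :=
  {x | 0 ≤ ⟪(x : E n), (w : E n)⟫}

/-- `μ` is concentrated on some closed hemisphere. -/
def ConcentratedOnClosedHemisphere {n : ℕ} (μ : Measure (Sph n)) : Prop :=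
  ∃ w : Sph n, μ (closedHemisphere w)ᶜ = 0

/-- The half-space `H^-(a, v) = {x : x · v ≤ a}`. -/
def halfSpace {n : ℕ} (a : ℝ) (v : Sph n) : Set (E n) :=
  {x | ⟪x, (v : E n)⟫ ≤ a}

/-- The polar body `K^* = {x : x · y ≤ 1 for all y ∈ K}`. -/
def polarBody {n : ℕ} (K : Set (E n)) : Set (E n) :=
  {x | ∀ y ∈ K, ⟪x, y⟫ ≤ 1}

/-- The class of polytopes containing the origin in their interior, of the form
`(⋂ i, H^-(a i, v i))^*` with all `a i > 0`, whose vertices are exactly the points `r_P(v i)`. -/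
def polytopesWithVertexDirections {n m : ℕ} (v : Fin m → Sph n) : Set (Set (E n)) :=
  {P | P ∈ convexBodiesO n ∧
    (∃ a : Fin m → ℝ, (∀ i, 0 < a i) ∧ P = polarBody (⋂ i, halfSpace (a i) (v i))) ∧
    P.extremePoints ℝ = Set.range (fun i => radialMap P (v i))}

/-- The set of assignment functions for `λ = ∑ j, a j • δ_{u j}` and `μ = ∑ i, b i • δ_{v i}`. -/
def assignmentFunctions {k m : ℕ} (a : Fin k → ℝ) (b : Fin m → ℝ) : Set (Fin k → Fin m) :=
  {f | ∀ i, ∑ j with f j = i, a j = b i}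

/-- The set of proper assignment functions: those with `u j · v (f j) > 0` for all `j`. -/
def properAssignmentFunctions {n k m : ℕ} (a : Fin k → ℝ) (u : Fin k → Sph n)
    (b : Fin m → ℝ) (v : Fin m → Sph n) : Set (Fin k → Fin m) :=
  {f | f ∈ assignmentFunctions a b ∧ ∀ j, 0 < ⟪(u j : E n), (v (f j) : E n)⟫}

open Classical in
/-- The logarithm with values in `[-∞, ∞]`, equal to `-∞` at non-positive reals. -/
def extLog (x : ℝ) : EReal :=
  if 0 < x then (Real.log x : EReal) else ⊥

/-- The assignment functional `A(f) = ∑ j, log (u j · v (f j))`. -/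
def assignmentFunctional {n k m : ℕ} (u : Fin k → Sph n) (v : Fin m → Sph n)
    (f : Fin k → Fin m) : EReal :=
  ∑ j, extLog ⟪(u j : E n), (v (f j) : E n)⟫

/-- `f` maximizes the assignment functional over the set of assignment functions. -/
def IsMaximizer {n k m : ℕ} (a : Fin k → ℝ) (u : Fin k → Sph n)
    (b : Fin m → ℝ) (v : Fin m → Sph n) (f : Fin k → Fin m) : Prop :=
  f ∈ assignmentFunctions a b ∧
    ∀ g ∈ assignmentFunctions a b, assignmentFunctional u v g ≤ assignmentFunctional u v f

/-- `f` is the only maximizer of the assignment functional over the set of assignment functions. -/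
def IsUniqueMaximizer {n k m : ℕ} (a : Fin k → ℝ) (u : Fin k → Sph n)
    (b : Fin m → ℝ) (v : Fin m → Sph n) (f : Fin k → Fin m) : Prop :=
  IsMaximizer a u b v f ∧ ∀ g, IsMaximizer a u b v g → g = f

/-- `K` realizes `f`: for every `j`, `u j` lies in the interior (relative to the sphere)
of the radial Gauss image of `v (f j)`. -/
def Realizes {n k m : ℕ} (u : Fin k → Sph n) (v : Fin m → Sph n) (K : Set (E n))
    (f : Fin k → Fin m) : Prop :=
  ∀ j, u j ∈ interior (radialGaussImage K {v (f j)})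

/-- `f` is a solution function: an assignment function realized by some body
`K` that solves the Gauss image problem `μ = λ(K, ·)`. -/
def IsSolutionFunction {n k m : ℕ} (a : Fin k → ℝ) (u : Fin k → Sph n)
    (b : Fin m → ℝ) (v : Fin m → Sph n) (f : Fin k → Fin m) : Prop :=
  f ∈ assignmentFunctions a b ∧
    ∃ K ∈ convexBodiesO n,
      SolvesGaussImage (discreteMeasure a u) (discreteMeasure b v) K ∧ Realizes u v K f

end GaussImage

end

/-! After taking logarithms the theorem is linear programming duality for an assignment problem,
with the logarithms of the radii as prices. The link between bodies and assignments is
`StrictlySupports`: numbers `ρ i > 0` such that, for each `j`, `ρ i * ⟪u j, v i⟫` is largest at `i =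
f j` only.

If `K` solves the problem, a count of normals shows that each `u j` is normal to `K` at exactly one
of the points `r_K(v i)`, so the radii of `K` strictly support the resulting `f`. Summing logarithms
over `j`, the contribution of the radii is the same for all assignments, hence `f` is the unique
maximizer of `A`.

Conversely, let `f` be the unique maximizer. Hall's theorem, fed by the weak Aleksandrov condition,
makes `A(f)` finite. Every rearrangement of `f` then loses a definite amount, and a shortest-path
potential yields strict prices `α`. With `ρ i = exp (α i)`, the convex hull of the points `ρ i • v
i` is the required polytope. Thus any solution `K` forces uniqueness, which gives the dichotomy. -/

noncomputable section

namespace GaussImage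

open MeasureTheory
open scoped RealInnerProductSpace ENNReal

/-! ### Shortest-path potentials and strict prices -/

section Potential

variable {ι : Type*}

/-- The total weight of the consecutive edges of a list of vertices. -/
def pathWeight (w : ι → ι → ℝ) : List ι → ℝ
  | [] => 0
  | [_] => 0
  | x :: y :: l => w x y + pathWeight w (y :: l)

lemma pathWeight_append_cons (w : ι → ι → ℝ) (s : List ι) (x : ι) (t : List ι) :
    pathWeight w (s ++ x :: t) = pathWeight w (s ++ [x]) + pathWeight w (x :: t) := by
  induction s with
  | nil => simp [pathWeight]
  | cons a s ih =>
    cases s with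
    | nil => simp [pathWeight]
    | cons b s =>
      simp only [List.cons_append, pathWeight] at ih ⊢
      rw [ih, add_assoc]

/-- Closes a simple path into a cycle, so that the permutation hypothesis of `exists_potential`
applies to it. Prepending `x` multiplies the cycle by a transposition, which changes the images of
`x` and of the last vertex only; points off the list are fixed and cost nothing. -/
lemma sum_formPerm [Fintype ι] [DecidableEq ι] (w : ι → ι → ℝ) (hw : ∀ i, w i i = 0)
    (x : ι) (l : List ι) (hl : (x :: l).Nodup) :
    ∑ z, w z ((x :: l).formPerm z) =
      pathWeight w (x :: l) + w ((x :: l).getLast (List.cons_ne_nil x l)) x := by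
  induction l generalizing x with
  | nil => simp [pathWeight, hw]
  | cons y l ih =>
    have hyl : (y :: l).Nodup := hl.of_cons
    have hx : x ∉ y :: l := (List.nodup_cons.1 hl).1
    have hxy : x ≠ y := fun h => hx (h ▸ List.mem_cons_self)
    specialize ih y hyl
    set e := (y :: l).getLast (List.cons_ne_nil y l) with he
    have hemem : e ∈ y :: l := List.getLast_mem _
    have hxe : x ≠ e := fun h => hx (h ▸ hemem)
    have hel : (x :: y :: l).getLast (List.cons_ne_nil x _) = e := List.getLast_cons _
    have h1 : (y :: l).formPerm x = x := List.formPerm_apply_of_notMem hx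
    have h2 : (y :: l).formPerm e = y := List.formPerm_apply_getLast y l
    have key : ∀ z, w z ((x :: y :: l).formPerm z) = w z ((y :: l).formPerm z)
        + ((if z = x then w x y else 0) + (if z = e then w e x - w e y else 0)) := by
      intro z
      rw [List.formPerm_cons_cons, Equiv.Perm.mul_apply]
      by_cases hzx : z = x
      · subst hzx
        simp [h1, hxe, hw]
      by_cases hze : z = e
      · rw [hze, h2]
        simp [Ne.symm hxe]
      · have h3 : (y :: l).formPerm z ≠ x := fun h =>
          hzx ((y :: l).formPerm.injective (h.trans h1.symm))
        have h4 : (y :: l).formPerm z ≠ y := fun h =>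
          hze ((y :: l).formPerm.injective (h.trans h2.symm))
        rw [Equiv.swap_apply_of_ne_of_ne h3 h4]
        simp [hzx, hze]
    rw [Finset.sum_congr rfl fun z _ => key z, Finset.sum_add_distrib, Finset.sum_add_distrib, ih,
      hel, Finset.sum_ite_eq', Finset.sum_ite_eq']
    simp only [Finset.mem_univ, if_true, pathWeight]
    ring

/-- A weight without negative cycles admits a potential. -/
lemma exists_potential [Fintype ι] (w : ι → ι → ℝ) (hw : ∀ i, w i i = 0)
    (hcyc : ∀ σ : Equiv.Perm ι, 0 ≤ ∑ i, w i (σ i)) :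
    ∃ γ : ι → ℝ, ∀ i j, γ i ≤ w i j + γ j := by
  classical
  -- The potential at `i` is the least weight of a simple path starting at `i`, with free endpoint;
  -- there are finitely many such paths.
  have hmin : ∀ i, ∃ l : List ι, (i :: l).Nodup ∧
      ∀ l', (i :: l').Nodup → pathWeight w (i :: l) ≤ pathWeight w (i :: l') := by
    intro i
    let s : Finset {l : List ι // l.Nodup} := Finset.univ.filter fun l => ∃ t, l.1 = i :: t
    have hs : s.Nonempty := ⟨⟨[i], List.nodup_singleton i⟩, by simp [s]⟩
    obtain ⟨l, hl, hle⟩ := Finset.exists_min_image s (fun l => pathWeight w l.1) hs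
    obtain ⟨t, ht⟩ := (Finset.mem_filter.1 hl).2
    refine ⟨t, ht ▸ l.2, fun l' hl' => ?_⟩
    rw [← ht]
    exact hle ⟨i :: l', hl'⟩ (by simp [s])
  choose p hp hpmin using hmin
  refine ⟨fun i => pathWeight w (i :: p i), fun i j => ?_⟩
  by_cases hi : i ∈ j :: p j
  -- If the best path from `j` passes through `i`, its part up to `i` together with the edge from
  -- `i` to `j` is a cycle, of nonnegative weight; the rest competes for the minimum at `i`.
  · obtain ⟨s, t, hst⟩ := List.append_of_mem hi
    have hnd := hp j
    rw [hst] at hnd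
    have h1 := hpmin i t hnd.of_append_right
    cases s with
    | nil =>
      simp only [List.nil_append, List.cons.injEq] at hst
      rw [hst.1, hw, zero_add]
    | cons c s =>
      simp only [List.cons_append, List.cons.injEq] at hst
      obtain ⟨rfl, hst⟩ := hst
      have h2 := pathWeight_append_cons w (j :: s) i t
      have hnd' : (j :: (s ++ [i])).Nodup := by
        have : (((j :: s) ++ [i]) ++ t).Nodup := by simpa using hnd
        simpa using this.of_append_left
      have h3 := sum_formPerm w hw j (s ++ [i]) hnd'
      have h4 := hcyc (j :: (s ++ [i])).formPerm
      have h5 : (j :: (s ++ [i])).getLast (List.cons_ne_nil _ _) = i := by simp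
      rw [h3, h5] at h4
      simp only [List.cons_append] at h2
      beta_reduce
      rw [hst, h2]
      linarith
  · exact hpmin i (j :: p j) (List.nodup_cons.2 ⟨hi, hp j⟩)

/-- If rearranging the values of `f` strictly decreases the total weight `∑ j, L j (f j)`, then
some prices make `f j` the strictly best choice for every `j`. -/
lemma exists_strict_prices {κ : Type*} [Fintype κ] (L : κ → ι → ℝ) (f : κ → ι)
    (hf : Function.Surjective f)
    (h : ∀ σ : Equiv.Perm κ, f ∘ σ ≠ f → ∑ j, L j (f (σ j)) < ∑ j, L j (f j)) :
    ∃ α : ι → ℝ, ∀ j i, i ≠ f j → L j i + α i < L j (f j) + α (f j) := by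
  classical
  obtain ⟨δ, hδ, hδle⟩ : ∃ δ : ℝ, 0 < δ ∧ ∀ σ : Equiv.Perm κ, f ∘ σ ≠ f →
      δ ≤ ∑ j, L j (f j) - ∑ j, L j (f (σ j)) := by
    let d : Equiv.Perm κ → ℝ := fun σ =>
      if f ∘ σ = f then 1 else ∑ j, L j (f j) - ∑ j, L j (f (σ j))
    obtain ⟨τ, -, hτ⟩ := Finset.exists_min_image Finset.univ d Finset.univ_nonempty
    refine ⟨d τ, ?_, fun σ hσ => ?_⟩
    · by_cases ht : f ∘ τ = f
      · simp [d, ht]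
      · simpa [d, ht] using h τ ht
    · simpa [d, hσ] using hτ σ (Finset.mem_univ σ)
  -- A permutation uses at most `card κ` edges, so lowering each edge between different fibres of
  -- `f` by `ε` costs at most the gap `δ` and creates no negative cycle.
  obtain ⟨ε, hε, hεδ⟩ : ∃ ε : ℝ, 0 < ε ∧ Fintype.card κ * ε ≤ δ := by
    refine ⟨δ / (Fintype.card κ + 1), by positivity, ?_⟩
    rw [mul_div_assoc', div_le_iff₀ (by positivity)]
    nlinarith
  obtain ⟨γ, hγ⟩ := exists_potential
    (fun j j' => L j (f j) - L j (f j') - if f j' = f j then 0 else ε) (by simp) (by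
      intro σ
      by_cases hσ : f ∘ σ = f
      · have : ∀ j, f (σ j) = f j := fun j => congrFun hσ j
        simp [this]
      · rw [Finset.sum_sub_distrib, Finset.sum_sub_distrib]
        have h1 : ∑ j, (if f (σ j) = f j then 0 else ε) ≤ ∑ _j : κ, ε :=
          Finset.sum_le_sum fun j _ => by split_ifs <;> linarith
        rw [Finset.sum_const, Finset.card_univ, nsmul_eq_mul] at h1
        linarith [hδle σ hσ])
  choose s hs using hf
  refine ⟨fun i => -γ (s i), fun j i hi => ?_⟩
  -- The edge to the representative of `i` carries the strict gain `ε`; the edge from the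
  -- representative of `f j` to `j` has weight zero.
  have h1 := hγ j (s i)
  have h2 := hγ (s (f j)) j
  simp only [hs, if_neg hi] at h1
  simp only [hs, if_true] at h2
  linarith

end Potential


/-! ### Hall's condition and the assignment functional -/

section Assignments

variable {n k m : ℕ} {u : Fin k → Sph n} {v : Fin m → Sph n} {N : Fin m → ℕ} {f g : Fin k → Fin m}

open Classical in
lemma discreteMeasure_natCast_apply (N : Fin m → ℕ) (x : Fin m → Sph n) (s : Set (Sph n)) :
    discreteMeasure (fun i => (N i : ℝ)) x s = ((∑ i with x i ∈ s, N i : ℕ) : ℝ≥0∞) := by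
  simp [discreteMeasure, Measure.dirac_apply, Set.indicator_apply, Finset.sum_filter]

open Classical in
lemma discreteMeasure_one_apply (x : Fin m → Sph n) (s : Set (Sph n)) :
    discreteMeasure (fun _ => (1 : ℝ)) x s = ((Finset.card {i | x i ∈ s} : ℕ) : ℝ≥0∞) := by
  have h := discreteMeasure_natCast_apply (fun _ => 1) x s
  simp only [Nat.cast_one] at h
  rw [h, Finset.card_eq_sum_ones]

lemma mem_assignmentFunctions_one :
    f ∈ assignmentFunctions (fun _ => (1 : ℝ)) (fun i => (N i : ℝ)) ↔
      ∀ i, Finset.card {j | f j = i} = N i := by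
  simp [assignmentFunctions]

/-- Both sums equal `∑ i, N i * φ i`. Taken with `φ = log ρ`, this makes the radii cancel when
assignments are compared. -/
lemma sum_comp_eq_of_mem_assignmentFunctions
    (hf : f ∈ assignmentFunctions (fun _ => (1 : ℝ)) (fun i => (N i : ℝ)))
    (hg : g ∈ assignmentFunctions (fun _ => (1 : ℝ)) (fun i => (N i : ℝ))) (φ : Fin m → ℝ) :
    ∑ j, φ (f j) = ∑ j, φ (g j) := by
  rw [mem_assignmentFunctions_one] at hf hg
  rw [← Finset.sum_fiberwise' Finset.univ f φ, ← Finset.sum_fiberwise' Finset.univ g φ]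
  simp [hf, hg]

lemma comp_perm_mem_assignmentFunctions
    (hf : f ∈ assignmentFunctions (fun _ => (1 : ℝ)) (fun i => (N i : ℝ)))
    (σ : Equiv.Perm (Fin k)) :
    f ∘ σ ∈ assignmentFunctions (fun _ => (1 : ℝ)) (fun i => (N i : ℝ)) := by
  rw [mem_assignmentFunctions_one] at hf ⊢
  intro i
  rw [← hf i]
  exact Finset.card_bij (fun j _ => σ j) (by simp) (by simp)
    (fun j hj => ⟨σ.symm j, by simpa using hj, by simp⟩)

lemma surjective_of_mem_assignmentFunctions (hN : ∀ i, 0 < N i)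
    (hf : f ∈ assignmentFunctions (fun _ => (1 : ℝ)) (fun i => (N i : ℝ))) :
    Function.Surjective f := by
  intro i
  have h := hN i
  rw [← mem_assignmentFunctions_one.1 hf i, Finset.card_pos] at h
  obtain ⟨j, hj⟩ := h
  exact ⟨j, by simpa using hj⟩

/-- The weak Aleksandrov condition provides Hall's condition, hence a proper assignment. -/
lemma properAssignmentFunctions_nonempty
    (hweak : WeakAleksandrovRelated (discreteMeasure (fun _ => (1 : ℝ)) u)
      (discreteMeasure (fun i => (N i : ℝ)) v)) :
    (properAssignmentFunctions (fun _ => (1 : ℝ)) u (fun i => (N i : ℝ)) v).Nonempty := by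
  classical
  obtain ⟨htot, hw⟩ := hweak
  rw [discreteMeasure_natCast_apply, discreteMeasure_one_apply, Nat.cast_inj] at htot
  simp only [Set.mem_univ, Finset.filter_true, Finset.card_univ, Fintype.card_fin] at htot
  -- Each `v i` is split into `N i` copies, each adjacent to the `u j` in its open hemisphere.
  have hall : ∀ s : Finset (Σ i, Fin (N i)), s.card ≤
      (s.biUnion fun c => ({j | 0 < ⟪(u j : E n), (v c.1 : E n)⟫} : Finset (Fin k))).card := by
    intro s
    set T := s.biUnion fun c => ({j | 0 < ⟪(u j : E n), (v c.1 : E n)⟫} : Finset (Fin k)) with hT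
    rcases s.eq_empty_or_nonempty with rfl | ⟨c₀, hc₀⟩
    · simp
    have hneg : ∀ j ∉ T, ∀ c ∈ s, ⟪(u j : E n), (v c.1 : E n)⟫ ≤ 0 := by
      intro j hj c hc
      by_contra hpos
      exact hj (Finset.mem_biUnion.2 ⟨c, hc, by simpa using hpos⟩)
    have hsI : s.card ≤ ∑ i ∈ s.image Sigma.fst, N i := by
      have hsub : s ⊆ (s.image Sigma.fst).sigma fun _ => Finset.univ := fun c hc =>
        Finset.mem_sigma.2 ⟨Finset.mem_image_of_mem _ hc, Finset.mem_univ _⟩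
      simpa using Finset.card_le_card hsub
    have hTc := Finset.card_add_card_compl T
    rw [Fintype.card_fin] at hTc
    -- If no `j` lies outside `T`, the set `ω` below would be the whole sphere, which is not
    -- admissible; the total masses suffice then.
    by_cases hTu : T = Finset.univ
    · rw [hTu, Finset.card_univ, Fintype.card_fin, htot]
      exact hsI.trans (Finset.sum_le_sum_of_subset (Finset.subset_univ _))
    obtain ⟨j₀, hj₀⟩ : ∃ j, j ∉ T := by
      by_contra hcon
      push Not at hcon
      exact hTu (Finset.eq_univ_iff_forall.2 hcon)
    -- The polar of the `u j` with `j ∉ T`: it contains the directions occurring in `s`, and its own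
    -- polar contains those `u j`. The Aleksandrov inequality for it is therefore Hall's inequality.
    let ω : Set (Sph n) := {x | ∀ j ∉ T, ⟪(u j : E n), (x : E n)⟫ ≤ 0}
    have hωc : IsClosed ω := by
      simp only [ω, Set.ofPred_forall]
      refine isClosed_iInter fun j => isClosed_iInter fun _ => isClosed_le ?_ continuous_const
      fun_prop
    have hvω : ∀ c ∈ s, v c.1 ∈ ω := fun c hc j hj => hneg j hj c hc
    have hcone : coneOf ω = {x | ∀ j ∉ T, ⟪(u j : E n), x⟫ ≤ 0} := by
      ext x
      constructor
      · rintro ⟨t, ht, y, hy, rfl⟩ j hj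
        rw [real_inner_smul_right]
        exact mul_nonpos_of_nonneg_of_nonpos ht (hy j hj)
      · intro hx
        by_cases hx0 : x = 0
        · exact ⟨0, le_rfl, v c₀.1, hvω c₀ hc₀, by simp [hx0]⟩
        have hxn : 0 < ‖x‖ := norm_pos_iff.2 hx0
        refine ⟨‖x‖, hxn.le, ⟨‖x‖⁻¹ • x, by simp [norm_smul, hxn.ne']⟩, fun j hj => ?_, ?_⟩
        · simp only [real_inner_smul_right]
          exact mul_nonpos_of_nonneg_of_nonpos (inv_nonneg.2 hxn.le) (hx j hj)
        · simp [smul_smul, hxn.ne']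
    have hconv : SphericallyConvex ω := by
      refine ⟨⟨0, 0, le_rfl, v c₀.1, hvω c₀ hc₀, by simp⟩, ?_, ?_⟩
      · rw [hcone]
        intro x hx y hy a b ha hb _ j hj
        rw [inner_add_right, real_inner_smul_right, real_inner_smul_right]
        exact add_nonpos (mul_nonpos_of_nonneg_of_nonpos ha (hx j hj))
          (mul_nonpos_of_nonneg_of_nonpos hb (hy j hj))
      · rw [hcone]
        intro huniv
        have h1 := huniv.symm ▸ Set.mem_univ (u j₀ : E n)
        have h2 := h1 j₀ hj₀
        rw [real_inner_self_eq_norm_sq, norm_eq_of_mem_sphere] at h2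
        norm_num at h2
    have h := hw ω hωc.isCompact hconv
    rw [discreteMeasure_natCast_apply, discreteMeasure_natCast_apply, discreteMeasure_one_apply,
      ← Nat.cast_add, Nat.cast_le] at h
    simp only [Set.mem_univ, Finset.filter_true] at h
    have h' : (∑ i with v i ∈ ω, N i) + Finset.card {j | u j ∈ polarSet ω} ≤ ∑ i, N i := by
      convert h
    have h3 : ∑ i ∈ s.image Sigma.fst, N i ≤ ∑ i with v i ∈ ω, N i := by
      refine Finset.sum_le_sum_of_subset fun i hi => ?_
      obtain ⟨c, hc, rfl⟩ := Finset.mem_image.1 hi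
      simpa using hvω c hc
    have h4 : Tᶜ.card ≤ Finset.card {j | u j ∈ polarSet ω} := by
      refine Finset.card_le_card fun j hj => ?_
      rw [Finset.mem_compl] at hj
      simp only [polarSet, Finset.mem_filter, Finset.mem_univ, true_and, Set.mem_iInter]
      intro x hx
      rw [Set.mem_ofPred_eq, real_inner_comm]
      exact hx j hj
    omega
  obtain ⟨c, hcinj, hc⟩ := (Finset.all_card_le_biUnion_card_iff_exists_injective _).1 hall
  have hcbij : Function.Bijective c :=
    (Fintype.bijective_iff_injective_and_card c).2 ⟨hcinj, by simp [htot]⟩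
  let e := Equiv.ofBijective c hcbij
  refine ⟨fun j => (e.symm j).1, mem_assignmentFunctions_one.2 fun i => ?_, fun j => ?_⟩
  · have hinj : Function.Injective fun t : Fin (N i) => e ⟨i, t⟩ := fun t t' htt => by
      simpa using htt
    have himg : ({j | (e.symm j).1 = i} : Finset (Fin k)) =
        Finset.univ.image fun t : Fin (N i) => e ⟨i, t⟩ := by
      ext j
      simp only [Finset.mem_filter, Finset.mem_univ, true_and, Finset.mem_image]
      constructor
      · rintro rfl
        exact ⟨(e.symm j).2, by simp⟩
      · rintro ⟨t, rfl⟩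
        simp
    rw [himg, Finset.card_image_of_injective _ hinj, Finset.card_univ, Fintype.card_fin]
  · have h := hc (e.symm j)
    have hj : c (e.symm j) = j := e.apply_symm_apply j
    rw [hj] at h
    simpa using h

lemma extLog_of_pos {x : ℝ} (hx : 0 < x) : extLog x = (Real.log x : EReal) := by simp [extLog, hx]

lemma assignmentFunctional_of_pos (h : ∀ j, 0 < ⟪(u j : E n), (v (f j) : E n)⟫) :
    assignmentFunctional u v f =
      ((∑ j, Real.log ⟪(u j : E n), (v (f j) : E n)⟫ : ℝ) : EReal) := by
  have hcoe : ∀ φ : Fin k → ℝ, ((∑ j, φ j : ℝ) : EReal) = ∑ j, (φ j : EReal) := fun φ =>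
    map_sum (⟨⟨Real.toEReal, EReal.coe_zero⟩, EReal.coe_add⟩ : ℝ →+ EReal) φ Finset.univ
  rw [hcoe]
  exact Finset.sum_congr rfl fun j _ => extLog_of_pos (h j)

lemma assignmentFunctional_eq_bot {j : Fin k} (h : ⟪(u j : E n), (v (f j) : E n)⟫ ≤ 0) :
    assignmentFunctional u v f = ⊥ := by
  rw [assignmentFunctional, ← Finset.add_sum_erase _ _ (Finset.mem_univ j), extLog,
    if_neg h.not_gt, EReal.bot_add]

/-- The points `ρ i • v i` are such that, for every `j`, the linear functional `⟪u j, ·⟫` has a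
positive maximum on them, attained at `ρ (f j) • v (f j)` only. -/
structure StrictlySupports (u : Fin k → Sph n) (v : Fin m → Sph n) (ρ : Fin m → ℝ)
    (f : Fin k → Fin m) : Prop where
  radius_pos : ∀ i, 0 < ρ i
  inner_pos : ∀ j, 0 < ⟪(u j : E n), (v (f j) : E n)⟫
  lt : ∀ j i, i ≠ f j →
    ρ i * ⟪(u j : E n), (v i : E n)⟫ < ρ (f j) * ⟪(u j : E n), (v (f j) : E n)⟫

lemma StrictlySupports.isUniqueMaximizer {ρ : Fin m → ℝ} (h : StrictlySupports u v ρ f)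
    (hf : f ∈ assignmentFunctions (fun _ => (1 : ℝ)) (fun i => (N i : ℝ))) :
    IsUniqueMaximizer (fun _ => 1) u (fun i => (N i : ℝ)) v f := by
  have key : ∀ g ∈ assignmentFunctions (fun _ : Fin k => (1 : ℝ)) (fun i => (N i : ℝ)), g ≠ f →
      assignmentFunctional u v g < assignmentFunctional u v f := by
    intro g hg hgf
    rw [assignmentFunctional_of_pos h.inner_pos]
    by_cases hgp : ∀ j, 0 < ⟪(u j : E n), (v (g j) : E n)⟫
    · rw [assignmentFunctional_of_pos hgp, EReal.coe_lt_coe_iff]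
      have hlog : ∀ j, g j ≠ f j →
          Real.log (ρ (g j)) + Real.log ⟪(u j : E n), (v (g j) : E n)⟫ <
            Real.log (ρ (f j)) + Real.log ⟪(u j : E n), (v (f j) : E n)⟫ := by
        intro j hj
        rw [← Real.log_mul (h.radius_pos _).ne' (hgp j).ne',
          ← Real.log_mul (h.radius_pos _).ne' (h.inner_pos j).ne']
        exact Real.log_lt_log (mul_pos (h.radius_pos _) (hgp j)) (h.lt j _ hj)
      obtain ⟨j₀, hj₀⟩ := Function.ne_iff.1 hgf
      have hsum : ∑ j, (Real.log (ρ (g j)) + Real.log ⟪(u j : E n), (v (g j) : E n)⟫) <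
          ∑ j, (Real.log (ρ (f j)) + Real.log ⟪(u j : E n), (v (f j) : E n)⟫) := by
        refine Finset.sum_lt_sum (fun j _ => ?_) ⟨j₀, Finset.mem_univ _, hlog j₀ hj₀⟩
        by_cases hj : g j = f j
        · rw [hj]
        · exact (hlog j hj).le
      rw [Finset.sum_add_distrib, Finset.sum_add_distrib,
        sum_comp_eq_of_mem_assignmentFunctions hg hf fun i => Real.log (ρ i)] at hsum
      linarith
    · push Not at hgp
      obtain ⟨j, hj⟩ := hgp
      rw [assignmentFunctional_eq_bot hj]
      exact EReal.bot_lt_coe _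
  refine ⟨⟨hf, fun g hg => ?_⟩, fun g hg => ?_⟩
  · by_cases hgf : g = f
    · rw [hgf]
    · exact (key g hg hgf).le
  · by_contra hgf
    exact (key g hg.1 hgf).not_ge (hg.2 f hf)

lemma IsUniqueMaximizer.exists_strictlySupports (hN : ∀ i, 0 < N i)
    (hp : (properAssignmentFunctions (fun _ => (1 : ℝ)) u (fun i => (N i : ℝ)) v).Nonempty)
    (h : IsUniqueMaximizer (fun _ => 1) u (fun i => (N i : ℝ)) v f) :
    ∃ ρ : Fin m → ℝ, StrictlySupports u v ρ f := by
  classical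
  obtain ⟨⟨hf, hmax⟩, huniq⟩ := h
  have hfp : ∀ j, 0 < ⟪(u j : E n), (v (f j) : E n)⟫ := by
    obtain ⟨p, hpF, hpp⟩ := hp
    by_contra hcon
    push Not at hcon
    obtain ⟨j, hj⟩ := hcon
    have h1 := hmax p hpF
    rw [assignmentFunctional_eq_bot hj, assignmentFunctional_of_pos hpp, le_bot_iff] at h1
    exact EReal.coe_ne_bot _ h1
  have hlog : ∀ j i, Real.log ⟪(u j : E n), (v i : E n)⟫ ≤ 0 ∨
      ⟪(u j : E n), (v i : E n)⟫ ≤ 0 := by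
    intro j i
    refine (le_or_gt ⟪(u j : E n), (v i : E n)⟫ 0).symm.imp (fun h0 => ?_) id
    refine Real.log_nonpos h0.le ((real_inner_le_norm _ _).trans ?_)
    simp
  set S := ∑ j, Real.log ⟪(u j : E n), (v (f j) : E n)⟫ with hS
  have hS0 : S ≤ 0 := Finset.sum_nonpos fun j _ => (hlog j (f j)).resolve_right (hfp j).not_ge
  -- A finite stand-in for `-∞`: since all entries are at most `0`, a sum with one entry `S - 1`
  -- stays below `S`.
  let L : Fin k → Fin m → ℝ := fun j i =>
    if 0 < ⟪(u j : E n), (v i : E n)⟫ then Real.log ⟪(u j : E n), (v i : E n)⟫ else S - 1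
  have hLpos : ∀ {j i}, 0 < ⟪(u j : E n), (v i : E n)⟫ →
      L j i = Real.log ⟪(u j : E n), (v i : E n)⟫ := fun h0 => if_pos h0
  have hL0 : ∀ j i, L j i ≤ 0 := by
    intro j i
    simp only [L]
    split_ifs with h0
    · exact (hlog j i).resolve_right h0.not_ge
    · linarith
  obtain ⟨α, hα⟩ := exists_strict_prices L f (surjective_of_mem_assignmentFunctions hN hf) (by
    intro σ hσ
    have hg := comp_perm_mem_assignmentFunctions hf σ
    have hSf : ∑ j, L j (f j) = S := Finset.sum_congr rfl fun j _ => hLpos (hfp j)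
    rw [hSf]
    by_cases hgp : ∀ j, 0 < ⟪(u j : E n), (v ((f ∘ σ) j) : E n)⟫
    · have hlt : assignmentFunctional u v (f ∘ σ) < assignmentFunctional u v f := by
        refine lt_of_le_of_ne (hmax _ hg) fun heq => hσ (huniq _ ⟨hg, fun g' hg' => ?_⟩)
        rw [heq]
        exact hmax g' hg'
      rw [assignmentFunctional_of_pos hgp, assignmentFunctional_of_pos hfp,
        EReal.coe_lt_coe_iff] at hlt
      refine lt_of_eq_of_lt (Finset.sum_congr rfl fun j _ => ?_) hlt
      exact hLpos (hgp j)
    · push Not at hgp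
      obtain ⟨j, hj⟩ := hgp
      rw [← Finset.add_sum_erase _ _ (Finset.mem_univ j)]
      have h1 : L j (f (σ j)) = S - 1 := if_neg hj.not_gt
      have h2 : ∑ j ∈ Finset.univ.erase j, L j (f (σ j)) ≤ 0 :=
        Finset.sum_nonpos fun j _ => hL0 _ _
      linarith)
  refine ⟨fun i => Real.exp (α i), fun i => Real.exp_pos _, hfp, fun j i hi => ?_⟩
  rcases le_or_gt ⟪(u j : E n), (v i : E n)⟫ 0 with h0 | h0
  · exact (mul_nonpos_of_nonneg_of_nonpos (Real.exp_pos _).le h0).trans_lt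
      (mul_pos (Real.exp_pos _) (hfp j))
  · have h1 := hα j i hi
    rw [hLpos h0, hLpos (hfp j)] at h1
    rw [← Real.exp_lt_exp, Real.exp_add, Real.exp_add, Real.exp_log h0, Real.exp_log (hfp j)] at h1
    linarith

end Assignments


/-! ### Normals of a body that solves the problem -/

section Bodies

variable {n k m : ℕ} {u : Fin k → Sph n} {v : Fin m → Sph n} {N : Fin m → ℕ} {f : Fin k → Fin m}
  {K : Set (E n)}

lemma exists_pos_smul_mem (hK : K ∈ convexBodiesO n) (w : Sph n) :
    ∃ a : ℝ, 0 < a ∧ a • (w : E n) ∈ K := by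
  have hc : Filter.Tendsto (fun a : ℝ => a • (w : E n)) (nhdsWithin 0 (Set.Ioi 0)) (nhds 0) := by
    have h : Continuous fun a : ℝ => a • (w : E n) := by fun_prop
    simpa using (h.tendsto 0).mono_left nhdsWithin_le_nhds
  have h1 := hc.eventually (mem_interior_iff_mem_nhds.1 hK.2.2)
  obtain ⟨a, ha, ha0⟩ := (h1.and self_mem_nhdsWithin).exists
  exact ⟨a, ha0, ha⟩

lemma isGreatest_radialFun (hK : K ∈ convexBodiesO n) (w : Sph n) :
    IsGreatest {a : ℝ | a • (w : E n) ∈ K} (radialFun K w) := by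
  have hcont : Continuous fun a : ℝ => a • (w : E n) := by fun_prop
  refine IsCompact.isGreatest_sSup ?_ ((exists_pos_smul_mem hK w).imp fun a h => h.2)
  refine Metric.isCompact_of_isClosed_isBounded (hK.1.isClosed.preimage hcont) ?_
  obtain ⟨R, hR⟩ := hK.1.isBounded.exists_norm_le
  refine isBounded_iff_forall_norm_le.2 ⟨R, fun a ha => ?_⟩
  simpa [norm_smul] using hR _ ha

lemma radialMap_mem (hK : K ∈ convexBodiesO n) (w : Sph n) : radialMap K w ∈ K :=
  (isGreatest_radialFun hK w).1

lemma radialFun_pos (hK : K ∈ convexBodiesO n) (w : Sph n) : 0 < radialFun K w := by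
  obtain ⟨a, ha, haK⟩ := exists_pos_smul_mem hK w
  exact ha.trans_le ((isGreatest_radialFun hK w).2 haK)

lemma inner_pos_of_mem_normalCone (hK : K ∈ convexBodiesO n) {x : E n} {w : Sph n}
    (hw : w ∈ normalCone K x) : 0 < ⟪x, (w : E n)⟫ := by
  obtain ⟨a, ha, haK⟩ := exists_pos_smul_mem hK w
  have h := hw _ haK
  rw [inner_sub_left, real_inner_smul_left, real_inner_self_eq_norm_sq, norm_eq_of_mem_sphere] at h
  linarith

lemma mem_radialGaussImage {ω : Set (Sph n)} {w : Sph n} :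
    w ∈ radialGaussImage K ω ↔ ∃ x ∈ ω, w ∈ normalCone K (radialMap K x) := by
  simp [radialGaussImage]

/-- Singletons and the whole support of `μ` are the only Borel sets tested; the rest is double
counting of pairs `(j, i)` with `u j` normal at `r_K(v i)`. -/
lemma exists_strictlySupports_of_solvesGaussImage (hK : K ∈ convexBodiesO n)
    (htot : discreteMeasure (fun _ => (1 : ℝ)) u Set.univ =
      discreteMeasure (fun i => (N i : ℝ)) v Set.univ)
    (hv : Function.Injective v)
    (hsol : SolvesGaussImage (discreteMeasure (fun _ => (1 : ℝ)) u)
      (discreteMeasure (fun i => (N i : ℝ)) v) K) :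
    ∃ f ∈ assignmentFunctions (fun _ : Fin k => (1 : ℝ)) (fun i => (N i : ℝ)),
      StrictlySupports u v (fun i => radialFun K (v i)) f ∧
      ∀ j i, u j ∈ radialGaussImage K {v i} ↔ i = f j := by
  classical
  rw [discreteMeasure_natCast_apply, discreteMeasure_one_apply, Nat.cast_inj] at htot
  simp only [Set.mem_univ, Finset.filter_true, Finset.card_univ, Fintype.card_fin] at htot
  have hfib : ∀ i, Finset.card {j | u j ∈ radialGaussImage K {v i}} = N i := by
    intro i
    have h := hsol {v i} (measurableSet_singleton _)
    rw [gaussImageMeasure, discreteMeasure_natCast_apply, discreteMeasure_one_apply,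
      Nat.cast_inj] at h
    rw [← h]
    simp [hv.eq_iff, Finset.sum_filter]
  have hex : ∀ j, ∃ i, u j ∈ radialGaussImage K {v i} := by
    intro j
    have h := hsol (Set.range v) (Set.finite_range v).measurableSet
    rw [gaussImageMeasure, discreteMeasure_natCast_apply, discreteMeasure_one_apply,
      Nat.cast_inj] at h
    simp only [Set.mem_range_self, Finset.filter_true] at h
    have hcard : Finset.card {j | u j ∈ radialGaussImage K (Set.range v)} =
        Fintype.card (Fin k) := by
      rw [← h, Fintype.card_fin, htot]
    have hmem := (Finset.card_eq_iff_eq_univ _).1 hcard ▸ Finset.mem_univ j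
    simp only [Finset.mem_filter, Finset.mem_univ, true_and] at hmem
    obtain ⟨_, ⟨i, rfl⟩, hi⟩ := mem_radialGaussImage.1 hmem
    exact ⟨i, mem_radialGaussImage.2 ⟨_, rfl, hi⟩⟩
  -- There are `k` such pairs in all, and each of the `k` indices `j` occurs in at least one.
  have hone : ∀ j, Finset.card {i | u j ∈ radialGaussImage K {v i}} = 1 := by
    have hle : ∀ j ∈ Finset.univ, 1 ≤ Finset.card {i | u j ∈ radialGaussImage K {v i}} := by
      intro j _
      obtain ⟨i, hi⟩ := hex j
      exact Finset.card_pos.2 ⟨i, by simpa using hi⟩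
    have hsum : ∑ _j : Fin k, 1 = ∑ j, Finset.card {i | u j ∈ radialGaussImage K {v i}} := by
      have hcomm := Finset.sum_card_bipartiteAbove_eq_sum_card_bipartiteBelow
        (s := (Finset.univ : Finset (Fin k))) (t := (Finset.univ : Finset (Fin m)))
        fun j i => u j ∈ radialGaussImage K {v i}
      simp only [Finset.bipartiteAbove, Finset.bipartiteBelow, hfib] at hcomm
      rw [hcomm]
      simp [htot]
    exact fun j => ((Finset.sum_eq_sum_iff_of_le hle).1 hsum j (Finset.mem_univ j)).symm
  have huniq : ∀ j, ∃ i, ∀ i', u j ∈ radialGaussImage K {v i'} ↔ i' = i := by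
    intro j
    obtain ⟨i, hi⟩ := Finset.card_eq_one.1 (hone j)
    refine ⟨i, fun i' => ?_⟩
    have h := Finset.ext_iff.1 hi i'
    simpa using h
  choose f hf using huniq
  refine ⟨f, mem_assignmentFunctions_one.2 fun i => ?_, ⟨fun i => radialFun_pos hK _, ?_, ?_⟩, hf⟩
  · rw [← hfib i]
    congr 1
    ext j
    simp [hf, eq_comm]
  · intro j
    obtain ⟨_, rfl, hj⟩ := mem_radialGaussImage.1 ((hf j (f j)).2 rfl)
    have h := inner_pos_of_mem_normalCone hK hj
    rw [radialMap, real_inner_smul_left, real_inner_comm] at h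
    exact (mul_pos_iff_of_pos_left (radialFun_pos hK _)).1 h
  · intro j i hi
    obtain ⟨_, rfl, hj⟩ := mem_radialGaussImage.1 ((hf j (f j)).2 rfl)
    by_contra hcon
    push Not at hcon
    -- If the strict inequality failed, `u j` would also be normal at `r_K(v i)`.
    refine hi ((hf j i).1 (mem_radialGaussImage.2 ⟨_, rfl, fun y hy => ?_⟩))
    have h := hj y hy
    simp only [radialMap, inner_sub_left, real_inner_smul_left] at h ⊢
    rw [real_inner_comm, real_inner_comm (v i : E n)] at hcon
    linarith

end Bodies

/-! ### The polytope spanned by the radii -/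

section Polytopes

variable {n k m : ℕ} {u : Fin k → Sph n} {v : Fin m → Sph n} {N : Fin m → ℕ} {f : Fin k → Fin m}

lemma exists_sphere_separation {K : Set (E n)} (hconv : Convex ℝ K) (hcl : IsClosed K)
    (hne : K.Nonempty) {y : E n} (hy : y ∉ K) :
    ∃ (w : Sph n) (s : ℝ), (∀ z ∈ K, ⟪z, (w : E n)⟫ < s) ∧ s < ⟪y, (w : E n)⟫ := by
  obtain ⟨φ, s, hφ, hs⟩ := geometric_hahn_banach_closed_point hconv hcl hy
  set w := (InnerProductSpace.toDual ℝ (E n)).symm φ with hw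
  have hφw : ∀ z, φ z = ⟪z, w⟫ := fun z => by
    rw [real_inner_comm, hw, InnerProductSpace.toDual_symm_apply]
  simp only [hφw] at hφ hs
  have hw0 : w ≠ 0 := by
    rintro h0
    obtain ⟨z, hz⟩ := hne
    have := hφ z hz
    rw [h0, inner_zero_right] at this hs
    linarith
  have hwn : 0 < ‖w‖ := norm_pos_iff.2 hw0
  refine ⟨⟨‖w‖⁻¹ • w, by simp [norm_smul, hwn.ne']⟩, ‖w‖⁻¹ * s, fun z hz => ?_, ?_⟩
  · rw [real_inner_smul_right]
    exact mul_lt_mul_of_pos_left (hφ z hz) (inv_pos.2 hwn)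
  · rw [real_inner_smul_right]
    exact mul_lt_mul_of_pos_left hs (inv_pos.2 hwn)

lemma exists_inner_pos_of_not_concentrated
    (h : ¬ ConcentratedOnClosedHemisphere (discreteMeasure (fun i => (N i : ℝ)) v)) (w : Sph n) :
    ∃ i, 0 < ⟪(v i : E n), (w : E n)⟫ := by
  classical
  by_contra! hcon
  have hnot : ∀ i, v i ∉ (closedHemisphere (-w))ᶜ := fun i hi =>
    hi (show 0 ≤ ⟪(v i : E n), ((-w : Sph n) : E n)⟫ by simpa using hcon i)
  refine h ⟨-w, ?_⟩
  rw [discreteMeasure_natCast_apply]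
  simp only [hnot, Finset.filter_false, Finset.sum_empty, Nat.cast_zero]

/-- The support function of the hull is continuous and positive on the compact sphere; its minimum
is the radius of a ball inside the hull. -/
lemma zero_mem_interior_convexHull (x : Fin m → E n)
    (hx : ∀ w : Sph n, ∃ i, 0 < ⟪x i, (w : E n)⟫) (hn : 1 ≤ n) :
    (0 : E n) ∈ interior (convexHull ℝ (Set.range x)) := by
  have : Nonempty (Fin n) := ⟨⟨0, hn⟩⟩
  have hS : (Set.univ : Set (Sph n)).Nonempty :=
    ⟨⟨_, (NormedSpace.sphere_nonempty.2 zero_le_one).some_mem⟩, trivial⟩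
  have hne : (Finset.univ : Finset (Fin m)).Nonempty :=
    ⟨(hx hS.some).choose, Finset.mem_univ _⟩
  let g : Sph n → ℝ := fun w => Finset.univ.sup' hne fun i => ⟪x i, (w : E n)⟫
  have hg : Continuous g := Continuous.finset_sup'_apply hne fun i _ => by fun_prop
  obtain ⟨w₀, -, hw₀⟩ := isCompact_univ.exists_isMinOn hS hg.continuousOn
  have hδ : 0 < g w₀ := by
    obtain ⟨i, hi⟩ := hx w₀
    exact (Finset.lt_sup'_iff _).2 ⟨i, Finset.mem_univ i, hi⟩
  rw [mem_interior_iff_mem_nhds, Metric.mem_nhds_iff]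
  refine ⟨g w₀, hδ, fun y hy => ?_⟩
  by_contra hyP
  obtain ⟨w, s, hw, hs⟩ := exists_sphere_separation (convex_convexHull ℝ _)
    ((Set.finite_range x).isClosed_convexHull ℝ) ⟨x hne.choose, subset_convexHull ℝ _ ⟨_, rfl⟩⟩ hyP
  obtain ⟨i, -, hi⟩ := Finset.exists_mem_eq_sup' hne fun i => ⟪x i, (w : E n)⟫
  have h1 : g w₀ ≤ ⟪x i, (w : E n)⟫ := by
    rw [← hi]
    exact hw₀ (Set.mem_univ w)
  have h2 := hw (x i) (subset_convexHull ℝ _ ⟨i, rfl⟩)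
  have h3 := real_inner_le_norm y (w : E n)
  rw [norm_eq_of_mem_sphere, mul_one] at h3
  rw [mem_ball_zero_iff] at hy
  linarith

lemma inner_le_of_mem_convexHull {x : Fin m → E n} {w : E n} {c : ℝ} (h : ∀ i, ⟪x i, w⟫ ≤ c)
    {y : E n} (hy : y ∈ convexHull ℝ (Set.range x)) : ⟪y, w⟫ ≤ c := by
  have hconv : Convex ℝ {y : E n | ⟪y, w⟫ ≤ c} := by
    intro y hy z hz a b ha hb hab
    rw [Set.mem_ofPred_eq] at hy hz ⊢
    rw [inner_add_left, real_inner_smul_left, real_inner_smul_left]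
    calc a * ⟪y, w⟫ + b * ⟪z, w⟫ ≤ a * c + b * c := by gcongr
      _ = c := by rw [← add_mul, hab, one_mul]
  exact convexHull_min (Set.range_subset_iff.2 h) hconv hy

/-- The point `x i₀` together with the open half-space below it is convex and contains all the `x
i`. -/
lemma eq_of_inner_le_of_mem_convexHull {x : Fin m → E n} {w : E n} {i₀ : Fin m}
    (h : ∀ i, i ≠ i₀ → ⟪x i, w⟫ < ⟪x i₀, w⟫) {y : E n} (hy : y ∈ convexHull ℝ (Set.range x))
    (hyw : ⟪x i₀, w⟫ ≤ ⟪y, w⟫) : y = x i₀ := by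
  have hconv : Convex ℝ {y : E n | y = x i₀ ∨ ⟪y, w⟫ < ⟪x i₀, w⟫} := by
    rw [convex_iff_forall_pos]
    intro y hy z hz a b ha hb hab
    by_cases hyz : y = x i₀ ∧ z = x i₀
    · left
      rw [hyz.1, hyz.2, ← add_smul, hab, one_smul]
    right
    rw [inner_add_left, real_inner_smul_left, real_inner_smul_left]
    have hc : ⟪x i₀, w⟫ = a * ⟪x i₀, w⟫ + b * ⟪x i₀, w⟫ := by rw [← add_mul, hab, one_mul]
    rcases hy with rfl | hy
    · rcases hz with rfl | hz
      · exact absurd ⟨rfl, rfl⟩ hyz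
      · have := mul_lt_mul_of_pos_left hz hb
        linarith
    · have h1 := mul_lt_mul_of_pos_left hy ha
      have h2 : b * ⟪z, w⟫ ≤ b * ⟪x i₀, w⟫ := by
        rcases hz with rfl | hz
        · exact le_rfl
        · exact (mul_lt_mul_of_pos_left hz hb).le
      linarith
  have hsub : Set.range x ⊆ {y : E n | y = x i₀ ∨ ⟪y, w⟫ < ⟪x i₀, w⟫} := by
    rintro _ ⟨i, rfl⟩
    by_cases hi : i = i₀
    · exact Or.inl (by rw [hi])
    · exact Or.inr (h i hi)
  exact (convexHull_min hsub hconv hy).resolve_right hyw.not_gt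

lemma eq_of_pos_smul_eq {w w' : Sph n} {a b : ℝ} (ha : 0 < a) (hb : 0 < b)
    (h : a • (w : E n) = b • (w' : E n)) : w = w' := by
  have hab : a = b := by
    have := congrArg norm h
    simpa [norm_smul, abs_of_pos ha, abs_of_pos hb] using this
  subst hab
  exact Subtype.ext (smul_right_injective _ ha.ne' h)

lemma StrictlySupports.exists_polytope {ρ : Fin m → ℝ} (hn : 1 ≤ n)
    (hN : ∀ i, 0 < N i) (h : StrictlySupports u v ρ f)
    (hf : f ∈ assignmentFunctions (fun _ => (1 : ℝ)) (fun i => (N i : ℝ)))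
    (hhemi : ¬ ConcentratedOnClosedHemisphere (discreteMeasure (fun i => (N i : ℝ)) v)) :
    ∃ P ∈ polytopesWithVertexDirections v,
      SolvesGaussImage (discreteMeasure (fun _ => (1 : ℝ)) u)
        (discreteMeasure (fun i => (N i : ℝ)) v) P ∧ Realizes u v P f := by
  classical
  have hsurj := surjective_of_mem_assignmentFunctions hN hf
  set x : Fin m → E n := fun i => ρ i • (v i : E n) with hx
  have hxinner : ∀ i (w : E n), ⟪x i, w⟫ = ρ i * ⟪w, (v i : E n)⟫ := fun i w => by
    rw [hx, real_inner_smul_left, real_inner_comm]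
  have hlt : ∀ j i, i ≠ f j → ⟪x i, (u j : E n)⟫ < ⟪x (f j), (u j : E n)⟫ := fun j i hi => by
    rw [hxinner, hxinner]
    exact h.lt j i hi
  set P := convexHull ℝ (Set.range x) with hP
  have hxP : ∀ i, x i ∈ P := fun i => subset_convexHull ℝ _ ⟨i, rfl⟩
  have hPcomp : IsCompact P := (Set.finite_range x).isCompact_convexHull ℝ
  have hPO : P ∈ convexBodiesO n := by
    refine ⟨hPcomp, convex_convexHull ℝ _, zero_mem_interior_convexHull x (fun w => ?_) hn⟩
    obtain ⟨i, hi⟩ := exists_inner_pos_of_not_concentrated hhemi w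
    refine ⟨i, ?_⟩
    rw [hx, real_inner_smul_left]
    exact mul_pos (h.radius_pos i) hi
  have hface : ∀ j, ∀ y ∈ P, ⟪x (f j), (u j : E n)⟫ ≤ ⟪y, (u j : E n)⟫ → y = x (f j) :=
    fun j y hy hle => eq_of_inner_le_of_mem_convexHull (hlt j) hy hle
  have hsupp : ∀ j, ∀ y ∈ P, ⟪y, (u j : E n)⟫ ≤ ⟪x (f j), (u j : E n)⟫ := fun j y hy =>
    le_of_not_gt fun hcon => hcon.ne' (by rw [hface j y hy hcon.le])
  have hrad : ∀ i, radialMap P (v i) = x i := by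
    intro i
    have hgr : IsGreatest {a : ℝ | a • (v i : E n) ∈ P} (ρ i) := by
      refine ⟨hxP i, fun a ha => ?_⟩
      -- Every index is some `f j`, so the functional `u j` bounds `P` in the direction `v (f j)`.
      obtain ⟨j, rfl⟩ := hsurj i
      have h1 := hsupp j _ ha
      rw [hxinner, real_inner_smul_left, real_inner_comm] at h1
      exact le_of_mul_le_mul_right h1 (h.inner_pos j)
    rw [radialMap, (isGreatest_radialFun hPO (v i)).unique hgr]
  -- The constraint `⟪z, ρ i • v i⟫ ≤ 1` reads `⟪z, v i⟫ ≤ (ρ i)⁻¹`, so the half-spaces cut out the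
  -- polar of `P`, and their polar is `P` by separation.
  refine ⟨P, ⟨hPO, ⟨fun i => (ρ i)⁻¹, fun i => inv_pos.2 (h.radius_pos i), ?_⟩, ?_⟩, ?_, ?_⟩
  · apply Set.Subset.antisymm
    · intro y hy z hz
      refine inner_le_of_mem_convexHull (fun i => ?_) hy
      have hzi : ⟪z, (v i : E n)⟫ ≤ (ρ i)⁻¹ := Set.mem_iInter.1 hz i
      rw [hxinner]
      calc ρ i * ⟪z, (v i : E n)⟫ ≤ ρ i * (ρ i)⁻¹ :=
            mul_le_mul_of_nonneg_left hzi (h.radius_pos i).le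
        _ = 1 := mul_inv_cancel₀ (h.radius_pos i).ne'
    · intro y hy
      by_contra hyP
      have h0 : (0 : E n) ∈ P := interior_subset hPO.2.2
      obtain ⟨w, s, hw, hs⟩ := exists_sphere_separation hPO.2.1 hPcomp.isClosed ⟨0, h0⟩ hyP
      have hs0 : 0 < s := by simpa using hw 0 h0
      have hmem : s⁻¹ • (w : E n) ∈ ⋂ i, halfSpace (ρ i)⁻¹ (v i) := by
        refine Set.mem_iInter.2 fun i => ?_
        have h1 := hw (x i) (hxP i)
        rw [hxinner] at h1
        rw [halfSpace, Set.mem_ofPred_eq, real_inner_smul_left, inv_mul_le_iff₀ hs0,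
          ← div_eq_mul_inv, le_div_iff₀ (h.radius_pos i)]
        linarith
      have h2 := hy _ hmem
      rw [real_inner_smul_right, inv_mul_le_iff₀ hs0] at h2
      linarith
  · simp only [hrad]
    refine Set.Subset.antisymm extremePoints_convexHull_subset ?_
    rintro _ ⟨i, rfl⟩
    obtain ⟨j, rfl⟩ := hsurj i
    refine mem_extremePoints.2 ⟨hxP _, fun y hy z hz hyz => ?_⟩
    obtain ⟨a, b, ha, hb, hab, hyz⟩ := hyz
    beta_reduce at hyz
    have hin : a * ⟪y, (u j : E n)⟫ + b * ⟪z, (u j : E n)⟫ = ⟪x (f j), (u j : E n)⟫ := by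
      rw [← hyz, inner_add_left, real_inner_smul_left, real_inner_smul_left]
    have hc : ⟪x (f j), (u j : E n)⟫ =
        a * ⟪x (f j), (u j : E n)⟫ + b * ⟪x (f j), (u j : E n)⟫ := by
      rw [← add_mul, hab, one_mul]
    have h1 := mul_le_mul_of_nonneg_left (hsupp j y hy) ha.le
    have h2 := mul_le_mul_of_nonneg_left (hsupp j z hz) hb.le
    exact ⟨hface j y hy (le_of_mul_le_mul_left (by linarith) ha),
      hface j z hz (le_of_mul_le_mul_left (by linarith) hb)⟩
  · intro ω _
    have hiff : ∀ j, u j ∈ radialGaussImage P ω ↔ v (f j) ∈ ω := by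
      intro j
      rw [mem_radialGaussImage]
      constructor
      · rintro ⟨w, hw, hj⟩
        have h1 := hj _ (hxP (f j))
        rw [inner_sub_left, sub_nonpos] at h1
        have h2 := hface j _ (radialMap_mem hPO w) h1
        rwa [← eq_of_pos_smul_eq (radialFun_pos hPO w) (h.radius_pos (f j)) h2]
      · refine fun hj => ⟨_, hj, fun y hy => ?_⟩
        rw [hrad, inner_sub_left, sub_nonpos]
        exact hsupp j y hy
    rw [gaussImageMeasure, discreteMeasure_natCast_apply, discreteMeasure_one_apply, Nat.cast_inj]
    simp only [hiff]
    rw [Finset.card_eq_sum_card_fiberwise (f := f) (t := {i | v i ∈ ω}) fun j hj => by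
      simpa using hj]
    refine Finset.sum_congr rfl fun i hi => ?_
    rw [← mem_assignmentFunctions_one.1 hf i, Finset.filter_filter]
    congr 1
    ext j
    simp only [Finset.mem_filter, Finset.mem_univ, true_and] at hi ⊢
    exact ⟨fun hj => ⟨hj ▸ hi, hj⟩, fun hj => hj.2⟩
  · intro j
    -- The finitely many strict inequalities at `u j` persist nearby, so nearby directions are
    -- normal at the same vertex.
    refine mem_interior.2 ⟨⋂ i, ⋂ _ : i ≠ f j, {w : Sph n | ⟪x i, (w : E n)⟫ <
      ⟪x (f j), (w : E n)⟫}, fun w hw => ?_, ?_, ?_⟩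
    · simp only [Set.mem_iInter, Set.mem_ofPred_eq] at hw
      refine mem_radialGaussImage.2 ⟨_, rfl, fun y hy => ?_⟩
      rw [hrad, inner_sub_left, sub_nonpos]
      refine inner_le_of_mem_convexHull (fun i => ?_) hy
      by_cases hi : i = f j
      · rw [hi]
      · exact (hw i hi).le
    · refine isOpen_iInter_of_finite fun i => isOpen_iInter_of_finite fun _ => isOpen_lt ?_ ?_ <;>
        fun_prop
    · simpa using hlt j

end Polytopes

end GaussImage

end

/-! ### The equivalence and the dichotomy -/

open GaussImage in
theorem theorem5p1 {n : ℕ} (hn : 1 ≤ n) {k m : ℕ}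
    -- the discrete equal-weight measure `λ = ∑ j, δ_{u j}`
    (u : Fin k → Sph n) (a : Fin k → ℝ) (ha : ∀ j, a j = 1)
    -- the discrete measure `μ = ∑ i, b i • δ_{v i}`
    (v : Fin m → Sph n) (hv : Function.Injective v)
    (b : Fin m → ℝ) (hb : ∀ i, 0 < b i) (hbN : ∀ i, ∃ N : ℕ, b i = N)
    (hweak : WeakAleksandrovRelated (discreteMeasure a u) (discreteMeasure b v))
    (hhemi : ¬ ConcentratedOnClosedHemisphere (discreteMeasure b v)) :
    (properAssignmentFunctions a u b v).Nonempty ∧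
    (∀ f ∈ assignmentFunctions a b,
      IsSolutionFunction a u b v f ↔ IsUniqueMaximizer a u b v f) ∧
    ((∃ f, IsUniqueMaximizer a u b v f ∧
        ∃ P ∈ polytopesWithVertexDirections v,
          SolvesGaussImage (discreteMeasure a u) (discreteMeasure b v) P ∧ Realizes u v P f) ∨
     ((∃ f g, IsMaximizer a u b v f ∧ IsMaximizer a u b v g ∧ f ≠ g) ∧
        ¬ ∃ K ∈ convexBodiesO n,
          SolvesGaussImage (discreteMeasure a u) (discreteMeasure b v) K)) := by
  choose N hbN using hbN
  obtain rfl : a = fun _ => 1 := funext ha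
  obtain rfl : b = fun i => (N i : ℝ) := funext hbN
  have hN : ∀ i, 0 < N i := fun i => Nat.cast_pos.1 (hb i)
  have hproper := properAssignmentFunctions_nonempty hweak
  have hpoly : ∀ f, IsUniqueMaximizer (fun _ => 1) u (fun i => (N i : ℝ)) v f →
      ∃ P ∈ polytopesWithVertexDirections v,
        SolvesGaussImage (discreteMeasure (fun _ => 1) u)
          (discreteMeasure (fun i => (N i : ℝ)) v) P ∧ Realizes u v P f := by
    intro f hf
    obtain ⟨ρ, hρ⟩ := hf.exists_strictlySupports hN hproper
    exact hρ.exists_polytope hn hN hf.1.1 hhemi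
  refine ⟨hproper, fun f hf => ⟨?_, fun h => ?_⟩, ?_⟩
  · rintro ⟨-, K, hK, hsol, hreal⟩
    obtain ⟨g, hg, hgK, hiff⟩ := exists_strictlySupports_of_solvesGaussImage hK hweak.1 hv hsol
    have hfg : f = g := funext fun j => (hiff j (f j)).1 (interior_subset (hreal j))
    rw [hfg]
    exact hgK.isUniqueMaximizer hg
  · obtain ⟨P, hP, hsol, hreal⟩ := hpoly f h
    exact ⟨hf, P, hP.1, hsol, hreal⟩
  · obtain ⟨f, hf⟩ : ∃ f, IsMaximizer (fun _ => 1) u (fun i => (N i : ℝ)) v f := by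
      obtain ⟨f, hf, hmax⟩ := Set.exists_max_image
        (assignmentFunctions (fun _ : Fin k => (1 : ℝ)) (fun i => (N i : ℝ)))
        (assignmentFunctional u v) (Set.toFinite _) (hproper.mono fun _ h => h.1)
      exact ⟨f, hf, hmax⟩
    by_cases huniq : ∀ g, IsMaximizer (fun _ => 1) u (fun i => (N i : ℝ)) v g → g = f
    · exact Or.inl ⟨f, ⟨hf, huniq⟩, hpoly f ⟨hf, huniq⟩⟩
    · push Not at huniq
      obtain ⟨g, hg, hgf⟩ := huniq
      refine Or.inr ⟨⟨g, f, hg, hf, hgf⟩, ?_⟩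
      rintro ⟨K, hK, hsol⟩
      -- Any solution `K` yields a unique maximizer `f'`, with which both `f` and `g` would
      -- coincide.
      obtain ⟨f', hf', hfK, -⟩ := exists_strictlySupports_of_solvesGaussImage hK hweak.1 hv hsol
      have h := hfK.isUniqueMaximizer hf'
      exact hgf ((h.2 g hg).trans (h.2 f hf).symm)
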